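/- Let $F$ be a field, let $n,m\ge 0$, and let $z_1,\dots,z_m\in F[x_1,\dots,x_n]$ be non-zero $F$-linear combinations of the variables $x_1,\dots,x_n$. Let $\Omega=F[x_1,\dots,x_n]\otimes\Lambda_F[dx_1,\dots,dx_n]$, where $\Lambda_F$ denotes the exterior algebra over $F$, let $T=z_1^{-1}\cdots z_m^{-1}\,\Omega$ be its localization at the (central) elements $z_i$, and for $z_i=\sum_j c_{ij}x_j$ put $dz_i=\sum_j c_{ij}\,dx_j$. Let $\Xi=F[t_1,\dots,t_m]\otimes\Lambda_F[u_1,\dots,u_m]$, let $\psi:\Xi\to T$ be the homomorphism of $F$-algebras with $t_i\mapsto z_i^{-1}$ and $u_i\mapsto z_i^{-1}dz_i$, let $K=\ker\psi$, and let $T_{\mathcal A}\subseteq T$ be the subalgebra over $F$ generated by $z_1^{-1},\dots,z_m^{-1},z_1^{-1}dz_1,\dots,z_m^{-1}dz_m$. For a linear relation $L=a_1z_{i_1}+\dots+a_kz_{i_k}=0$ with $k\ge 1$, $1\le i_1<\dots<i_k\le m$ and all $a_r\in F\smallsetminus\{0\}$, put $|L|=\{i_1,\dots,i_k\}$ and $$P_L=\sum_{r=1}^k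 a_r\,t_{i_1}\cdots\widehat{t_{i_r}}\cdots t_{i_k}\in\Xi .$$ In the localization $t_1^{-1}\cdots t_m^{-1}\Xi$ write, by abuse of notation, $dz_i=t_i^{-1}u_i$ and $dL=a_1dz_{i_1}+\dots+a_kdz_{i_k}$, and for $S=\{j_1<\dots<j_l\}\subseteq|L|$ let $$P_{L,S}=P_L\,dz_{j_1}\cdots dz_{j_l}-\sum_{s=1}^l\Bigl(\prod_{i\in|L|\smallsetminus\{j_s\}}t_i\Bigr)\,dz_{j_1}\cdots dz_{j_{s-1}}\,dL\,dz_{j_{s+1}}\cdots dz_{j_l}.$$ Then each $P_{L,S}$ is (the image of a unique element) in $\Xi$, and the two-sided ideal $K$ of $\Xi$ is generated by all the elements $P_{L,S}$, where $L$ runs over all linear relations among the $z_i$ as above and $S$ over all subsets of $|L|$: $$K=(P_{L,S}).$$ In other words, $\psi$ induces an isomorphism of $F$-algebras $\Xi/(P_{L,S})\cong T_{\mathcal A}$. -/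

import Mathlib

open scoped TensorProduct

noncomputable section

namespace RecipPlane

variable {F : Type*} [Field F] {n m : ℕ}

/-- The polynomial de Rham ring `F[x₁, …, xₙ] ⊗ Λ[dx₁, …, dxₙ]`. The polynomial generators are even
and central, so that the graded tensor product is the plain tensor product of algebras. The vector
`w : Fin n → F` of `Fin n → F` stands for the form `∑ j, w j dxⱼ`. -/
abbrev SuperPoly (F : Type*) [Field F] (n : ℕ) : Type _ :=
  MvPolynomial (Fin n) F ⊗[F] ExteriorAlgebra F (Fin n → F)

/-- The multiplicative set generated by a family of polynomials. -/
abbrev denominators (z : Fin m → MvPolynomial (Fin n) F) : Submonoid (MvPolynomial (Fin n) F) :=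
  Submonoid.closure (Set.range z)

/-- The localization `z₁⁻¹ ⋯ zₘ⁻¹ (F[x] ⊗ Λ[dx])`, written as `(z₁⁻¹ ⋯ zₘ⁻¹ F[x]) ⊗ Λ[dx]`; see
`isLocalizedModule_toLoc`. -/
abbrev SuperLoc (z : Fin m → MvPolynomial (Fin n) F) : Type _ :=
  Localization (denominators z) ⊗[F] ExteriorAlgebra F (Fin n → F)

/-- The canonical homomorphism of `F[x] ⊗ Λ[dx]` to its localization. -/
def toLoc (z : Fin m → MvPolynomial (Fin n) F) : SuperPoly F n →ₐ[F] SuperLoc z :=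
  Algebra.TensorProduct.map
    (IsScalarTower.toAlgHom F (MvPolynomial (Fin n) F) (Localization (denominators z)))
    (AlgHom.id F (ExteriorAlgebra F (Fin n → F)))

/-- The element `zᵢ⁻¹` of the localization. -/
def zInv (z : Fin m → MvPolynomial (Fin n) F) (i : Fin m) : SuperLoc z :=
  (Localization.mk 1 ⟨z i, Submonoid.subset_closure (Set.mem_range_self i)⟩ :
    Localization (denominators z)) ⊗ₜ[F] 1

/-- The form `∑ j, w j dxⱼ` in the localization. -/
def form (z : Fin m → MvPolynomial (Fin n) F) (w : Fin n → F) : SuperLoc z :=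
  1 ⊗ₜ[F] ExteriorAlgebra.ι F w

/-- `SuperLoc z` is the localization of `SuperPoly F n` at the products of the `zᵢ`. -/
theorem isLocalizedModule_toLoc (z : Fin m → MvPolynomial (Fin n) F) :
    ∃ f : SuperPoly F n →ₗ[MvPolynomial (Fin n) F] SuperLoc z,
      (∀ x, f x = toLoc z x) ∧ IsLocalizedModule (denominators z) f := by
  let e := (TensorProduct.AlgebraTensorModule.cancelBaseChange F (MvPolynomial (Fin n) F)
    (Localization (denominators z)) (Localization (denominators z))
    (ExteriorAlgebra F (Fin n → F))).restrictScalars (MvPolynomial (Fin n) F)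
  let g := TensorProduct.mk (MvPolynomial (Fin n) F) (Localization (denominators z))
    (SuperPoly F n) 1
  refine ⟨e.toLinearMap ∘ₗ g, fun x => ?_, inferInstance⟩
  induction x using TensorProduct.induction_on with
  | zero => simp
  | tmul p w => simp [e, g, toLoc, Algebra.smul_def]
  | add x y hx hy => rw [map_add, map_add, hx, hy]

/-- `zᵢ⁻¹` is inverse to `zᵢ`. -/
theorem zInv_mul (z : Fin m → MvPolynomial (Fin n) F) (i : Fin m) :
    zInv z i * toLoc z (z i ⊗ₜ[F] 1) = 1 := by
  have h : (Localization.mk 1 ⟨z i, Submonoid.subset_closure (Set.mem_range_self i)⟩ :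
      Localization (denominators z)) * algebraMap _ _ (z i) = 1 := by
    rw [Localization.mk_eq_mk', mul_comm]
    simp
  simp only [zInv, toLoc, Algebra.TensorProduct.map_tmul, Algebra.TensorProduct.tmul_mul_tmul,
    IsScalarTower.coe_toAlgHom', map_one, mul_one, h]
  rfl

/-- The linear form `∑ j, c j xⱼ`. -/
def linForm (c : Fin n → F) : MvPolynomial (Fin n) F :=
  ∑ j, MvPolynomial.C (c j) * MvPolynomial.X j

/-- The linear forms `z₁, …, zₘ` with coefficient vectors `c₁, …, cₘ`. -/
abbrev forms (c : Fin m → Fin n → F) : Fin m → MvPolynomial (Fin n) F := fun i => linForm (c i)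

/-- `dzᵢ / zᵢ` in `T = z₁⁻¹ ⋯ zₘ⁻¹ (F[x] ⊗ Λ[dx])`. -/
def dlog (c : Fin m → Fin n → F) (i : Fin m) : SuperLoc (forms c) :=
  zInv (forms c) i * form (forms c) (c i)

theorem dlog_mul_dlog_add (c : Fin m → Fin n → F) (i j : Fin m) :
    dlog c i * dlog c j + dlog c j * dlog c i = 0 := by
  simp only [dlog, zInv, form, Algebra.TensorProduct.tmul_mul_tmul, mul_one, one_mul]
  rw [mul_comm (Localization.mk 1 ⟨forms c j, _⟩), ← TensorProduct.tmul_add,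
    ExteriorAlgebra.ι_add_mul_swap, TensorProduct.tmul_zero]

theorem dlog_mul_self (c : Fin m → Fin n → F) (i : Fin m) : dlog c i * dlog c i = 0 := by
  simp [dlog, zInv, form]

theorem sum_dlog_sq (c : Fin m → Fin n → F) (v : Fin m → F) (s : Finset (Fin m)) :
    (∑ i ∈ s, v i • dlog c i) * (∑ i ∈ s, v i • dlog c i) = 0 := by
  induction s using Finset.induction_on with
  | empty => simp
  | insert k s hk ih =>
    have h : (v k • dlog c k) * (∑ i ∈ s, v i • dlog c i) +
        (∑ i ∈ s, v i • dlog c i) * (v k • dlog c k) = 0 := by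
      rw [Finset.mul_sum, Finset.sum_mul, ← Finset.sum_add_distrib]
      refine Finset.sum_eq_zero fun i _ => ?_
      rw [smul_mul_smul_comm, smul_mul_smul_comm, mul_comm (v i), ← smul_add,
        dlog_mul_dlog_add, smul_zero]
    rw [Finset.sum_insert hk, add_mul, mul_add, mul_add, ih, smul_mul_smul_comm, dlog_mul_self,
      smul_zero, zero_add, add_zero, h]

theorem commute_tmul_one {z : Fin m → MvPolynomial (Fin n) F}
    (r : Localization (denominators z)) (y : SuperLoc z) :
    Commute (r ⊗ₜ[F] (1 : ExteriorAlgebra F (Fin n → F)) : SuperLoc z) y := by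
  induction y using TensorProduct.induction_on with
  | zero => exact Commute.zero_right _
  | tmul a b =>
    simp only [Commute, SemiconjBy, Algebra.TensorProduct.tmul_mul_tmul, one_mul, mul_one, mul_comm]
  | add x y hx hy => exact hx.add_right hy

/-- The homomorphism `F[t₁, …, tₘ] → T` with `tᵢ ↦ zᵢ⁻¹`. -/
def psiEven (c : Fin m → Fin n → F) : MvPolynomial (Fin m) F →ₐ[F] SuperLoc (forms c) :=
  Algebra.TensorProduct.includeLeft.comp (MvPolynomial.aeval fun i =>
    (Localization.mk 1 ⟨forms c i, Submonoid.subset_closure (Set.mem_range_self i)⟩ :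
      Localization (denominators (forms c))))

/-- The homomorphism `Λ[u₁, …, uₘ] → T` with `uᵢ ↦ zᵢ⁻¹ dzᵢ`. -/
def psiOdd (c : Fin m → Fin n → F) : ExteriorAlgebra F (Fin m → F) →ₐ[F] SuperLoc (forms c) :=
  ExteriorAlgebra.lift F ⟨Fintype.linearCombination F (dlog c), fun v => by
    simpa only [Fintype.linearCombination_apply] using sum_dlog_sq c v Finset.univ⟩

theorem commute_psiEven_psiOdd (c : Fin m → Fin n → F) (p : MvPolynomial (Fin m) F)
    (w : ExteriorAlgebra F (Fin m → F)) : Commute (psiEven c p) (psiOdd c w) :=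
  commute_tmul_one _ _

/-- The homomorphism `ψ : F[t₁, …, tₘ] ⊗ Λ[u₁, …, uₘ] → T` with `tᵢ ↦ zᵢ⁻¹`, `uᵢ ↦ zᵢ⁻¹ dzᵢ`. -/
def psi (c : Fin m → Fin n → F) : SuperPoly F m →ₐ[F] SuperLoc (forms c) :=
  Algebra.TensorProduct.lift (psiEven c) (psiOdd c) (commute_psiEven_psiOdd c)

/-- The generator `tᵢ` of `F[t] ⊗ Λ[u]`. -/
def t (F : Type*) [Field F] {m : ℕ} (i : Fin m) : SuperPoly F m := MvPolynomial.X i ⊗ₜ[F] 1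

/-- The generator `uᵢ` of `F[t] ⊗ Λ[u]`. -/
def u (F : Type*) [Field F] {m : ℕ} (i : Fin m) : SuperPoly F m :=
  1 ⊗ₜ[F] ExteriorAlgebra.ι F (Pi.single i 1)

theorem psi_t (c : Fin m → Fin n → F) (i : Fin m) : psi c (t F i) = zInv (forms c) i := by
  simp [psi, t, psiEven, zInv]

theorem psi_u (c : Fin m → Fin n → F) (i : Fin m) : psi c (u F i) = dlog c i := by
  simp [psi, u, psiOdd, Fintype.linearCombination_apply_single]

/-- The subring `T_𝒜` of `T` generated over `F` by the `zᵢ⁻¹` and the `zᵢ⁻¹ dzᵢ`. -/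
def recipRing (c : Fin m → Fin n → F) : Subalgebra F (SuperLoc (forms c)) :=
  Algebra.adjoin F (Set.range (zInv (forms c)) ∪ Set.range (dlog c))

/-- The index set `|L|` of the linear combination `L = ∑ i, aᵢ zᵢ`: the `i` with `aᵢ ≠ 0`. -/
def supp (a : Fin m → F) : Finset (Fin m) :=
  open Classical in Finset.univ.filter fun i => a i ≠ 0

/-- `L = ∑ i, aᵢ zᵢ` is a (nonzero) linear relation among the forms `zᵢ`. -/
def IsRelation (c : Fin m → Fin n → F) (a : Fin m → F) : Prop :=
  a ≠ 0 ∧ ∑ i, a i • forms c i = 0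

/-- The localization `t₁⁻¹ ⋯ tₘ⁻¹ (F[t] ⊗ Λ[u])`. -/
abbrev XiLoc (F : Type*) [Field F] (m : ℕ) : Type _ :=
  SuperLoc (MvPolynomial.X : Fin m → MvPolynomial (Fin m) F)

/-- The canonical homomorphism of `F[t] ⊗ Λ[u]` to its localization. -/
abbrev toXiLoc (F : Type*) [Field F] (m : ℕ) : SuperPoly F m →ₐ[F] XiLoc F m :=
  toLoc (MvPolynomial.X : Fin m → MvPolynomial (Fin m) F)

/-- The element `dzᵢ = tᵢ⁻¹ uᵢ` of `t₁⁻¹ ⋯ tₘ⁻¹ (F[t] ⊗ Λ[u])`. -/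
def dz (F : Type*) [Field F] {m : ℕ} (i : Fin m) : XiLoc F m :=
  zInv MvPolynomial.X i * toXiLoc F m (u F i)

/-- The element `dL = ∑_{i ∈ |L|} aᵢ dzᵢ`. -/
def dL (a : Fin m → F) : XiLoc F m := ∑ i ∈ supp a, a i • dz F i

/-- The product of the `tᵢ` with `i ∈ I`. -/
def tProd (F : Type*) [Field F] {m : ℕ} (I : Finset (Fin m)) : SuperPoly F m :=
  (∏ i ∈ I, MvPolynomial.X i) ⊗ₜ[F] 1

/-- `P_L = ∑_{i ∈ |L|} aᵢ ∏_{k ∈ |L|, k ≠ i} tₖ`. -/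
def relPoly (a : Fin m → F) : SuperPoly F m := ∑ i ∈ supp a, a i • tProd F ((supp a).erase i)

/-- The product `f_{j₁} ⋯ f_{jₗ}` for `S = {j₁ < ⋯ < jₗ}`. -/
def ordProd {A : Type*} [Monoid A] (f : Fin m → A) (S : Finset (Fin m)) : A :=
  (S.sort.map f).prod

/-- `P_{L,S} = P_L dz_{j₁} ⋯ dz_{jₗ}
  - ∑ₛ (∏_{k ∈ |L|, k ≠ jₛ} tₖ) dz_{j₁} ⋯ dL ⋯ dz_{jₗ}` for `S = {j₁ < ⋯ < jₗ}`, where in the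
summand of `s` the factor `dz_{jₛ}` is replaced by `dL`; an element of the localization of
`F[t] ⊗ Λ[u]`. -/
def relElt (a : Fin m → F) (S : Finset (Fin m)) : XiLoc F m :=
  toXiLoc F m (relPoly a) * ordProd (dz F) S -
    ∑ s ∈ S, toXiLoc F m (tProd F ((supp a).erase s)) *
      ordProd (Function.update (dz F) s (dL a)) S

/-- The set of all elements `P_{L,S}`, as elements of `F[t] ⊗ Λ[u]`, where `L` runs over all linear
relations among the `zᵢ`, and `S` over the subsets of `|L|`. -/
def relSet (c : Fin m → Fin n → F) : Set (SuperPoly F m) :=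
  {p | ∃ (a : Fin m → F) (S : Finset (Fin m)),
    IsRelation c a ∧ S ⊆ supp a ∧ toXiLoc F m p = relElt a S}

end RecipPlane

end

open scoped TensorProduct

noncomputable section

namespace RecipPlane

/-! ### Products of anticommuting elements and the expansion of `P_{L,S}` -/

section OrderedProducts

variable {ι A : Type*} [Ring A] {m : ℕ}

/-! The relations lie in the kernel because in `T` a linear relation holds for the `zᵢ` and for the
`dzᵢ` alike: `dL` becomes `0`, and `P_L = (∏ tᵢ) L` becomes `0` as well.

The converse is a standard monomial argument. Expanding `dL` (`relation_identity`) turns `P_{L,S}`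
into the sum over `r ∈ |L| \ S` of `a_r ∏_{i ∈ |L| \ (S ∪ r)} tᵢ` times `u_S` minus the products
obtained from `u_S` by replacing one `u_s` by `u_r`. Each monomial that occurs omits exactly one
index of `|L|`: `r`, or the replaced `s`. If `tᵢ` and `uᵢ` have weight `m - i`, the heaviest
monomial is the one that omits `j = max |L|`, namely `t_{|L| \ (S ∪ j)} u_S`. Varying `S` gives
every way of distributing `|L| \ {j}` between even and odd generators. Hence modulo the relations
every monomial reduces to standard ones, whose support contains no `|L| \ {max |L|}`
(`listMono_mem_stdSpan`).

Standard monomials have linearly independent images in `T` (`stdIndep`). After clearing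
denominators, the terms with the highest pole along `z_k`, for `k` the smallest index, are isolated
by restriction to the hyperplane `z_k = 0`; those with and those without a factor `dz_k` are
separated by a contraction. Projection along `c k` preserves standardness (`IsStd.project`), which
makes the induction on the index set possible. So a kernel element, reduced to standard form modulo
the relations, becomes `0` (`ker_le_span_relSet`). -/

theorem prod_map_perm {f : ι → A} (hf : ∀ i j, f i * f j + f j * f i = 0) {l l' : List ι}
    (h : l.Perm l') : (l.map f).prod = (l'.map f).prod ∨ (l.map f).prod = -(l'.map f).prod := by
  induction h with
  | nil => simp
  | cons x _ ih => rcases ih with ih | ih <;> simp [ih]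
  | swap x y l =>
    right
    simp only [List.map_cons, List.prod_cons, ← mul_assoc]
    rw [eq_neg_of_add_eq_zero_left (hf y x), neg_mul]
  | trans _ _ ih₁ ih₂ => rcases ih₁ with h₁ | h₁ <;> rcases ih₂ with h₂ | h₂ <;> simp [h₁, h₂]

theorem prod_map_eq_zero_of_not_nodup {f : ι → A} (hf : ∀ i j, f i * f j + f j * f i = 0)
    (hf0 : ∀ i, f i * f i = 0) {l : List ι} (h : ¬ l.Nodup) : (l.map f).prod = 0 := by
  classical
  induction l with
  | nil => simp at h
  | cons x l ih =>
    by_cases hx : x ∈ l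
    · rcases prod_map_perm hf (List.perm_cons_erase hx) with h' | h' <;>
        simp [h', ← mul_assoc, hf0]
    · have : ¬ l.Nodup := fun h' => h (List.nodup_cons.2 ⟨hx, h'⟩)
      simp [ih this]

theorem ordProd_update_comp (f : Fin m → A) (r s : Fin m) (S : Finset (Fin m)) :
    ordProd (Function.update f s (f r)) S = ((S.sort.map (Function.update id s r)).map f).prod := by
  rw [ordProd, List.map_map]
  congr 2
  funext i
  by_cases h : i = s
  · subst h; simp
  · simp [h]

theorem ordProd_update_eq_zero {f : Fin m → A} (hf : ∀ i j, f i * f j + f j * f i = 0)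
    (hf0 : ∀ i, f i * f i = 0) {r s : Fin m} {S : Finset (Fin m)} (hs : s ∈ S) (hr : r ∈ S)
    (hrs : r ≠ s) : ordProd (Function.update f s (f r)) S = 0 := by
  rw [ordProd_update_comp]
  refine prod_map_eq_zero_of_not_nodup hf hf0 fun h => hrs ?_
  exact List.inj_on_of_nodup_map h ((Finset.mem_sort _).2 hr) ((Finset.mem_sort _).2 hs)
    (by simp [hrs])

/-- Makes the product visibly linear in the factor at `s`, so that a sum such as `dL` can be
expanded there. -/
theorem exists_ordProd_update (f : Fin m → A) {s : Fin m} {S : Finset (Fin m)} (hs : s ∈ S) :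
    ∃ P Q : A, ∀ x, ordProd (Function.update f s x) S = P * x * Q := by
  obtain ⟨l₁, l₂, h⟩ := List.append_of_mem ((Finset.mem_sort (· ≤ ·)).2 hs)
  have hd : (l₁ ++ s :: l₂).Nodup := h ▸ Finset.sort_nodup S (· ≤ ·)
  rw [List.nodup_middle, List.nodup_cons, List.mem_append, not_or] at hd
  refine ⟨(l₁.map f).prod, (l₂.map f).prod, fun x => ?_⟩
  have key : ∀ l : List (Fin m), s ∉ l → l.map (Function.update f s x) = l.map f := fun l hl =>
    List.map_congr_left fun i hi => Function.update_of_ne (ne_of_mem_of_not_mem hi hl) _ _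
  rw [ordProd, h, List.map_append, List.map_cons, key _ hd.1.1, key _ hd.1.2]
  simp [mul_assoc]

theorem ordProd_insert {f : Fin m → A} {k : Fin m} {S : Finset (Fin m)} (h : ∀ i ∈ S, k < i) :
    ordProd f (insert k S) = f k * ordProd f S := by
  rw [ordProd, Finset.sort_insert _ (fun i hi => (h i hi).le) (fun hk => lt_irrefl _ (h k hk))]
  simp [ordProd]

theorem map_ordProd {B : Type*} [Ring B] (φ : A →+* B) (f : Fin m → A) (S : Finset (Fin m)) :
    φ (ordProd f S) = ordProd (fun i => φ (f i)) S := by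
  simp [ordProd, map_list_prod, Function.comp_def]

theorem ordProd_smul {R : Type*} [CommRing R] [Algebra R A] (g : Fin m → R) (f : Fin m → A)
    (S : Finset (Fin m)) :
    ordProd (fun i => g i • f i) S = (∏ i ∈ S, g i) • ordProd f S := by
  have key : ∀ l : List (Fin m),
      (l.map fun i => g i • f i).prod = (l.map g).prod • (l.map f).prod := fun l => by
    induction l with
    | nil => simp
    | cons x l ih => simp only [List.map_cons, List.prod_cons, ih, smul_mul_smul_comm]
  rw [ordProd, key, ordProd]
  congr 1
  rw [← Finset.prod_map_toList]
  exact ((Finset.sort_perm_toList S (· ≤ ·)).map g).prod_eq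

variable {F R : Type*} [Field F] [CommRing R] [Algebra F R] [Algebra R A] [Algebra F A]
  [IsScalarTower F R A]

theorem ordProd_update_sum {δ : Fin m → A} (hδ : ∀ i j, δ i * δ j + δ j * δ i = 0)
    (hδ0 : ∀ i, δ i * δ i = 0) (a : Fin m → F) {s : Fin m} {S L : Finset (Fin m)} (hs : s ∈ S)
    (hSL : S ⊆ L) :
    ordProd (Function.update δ s (∑ i ∈ L, a i • δ i)) S =
      a s • ordProd δ S + ∑ r ∈ L \ S, a r • ordProd (Function.update δ s (δ r)) S := by
  obtain ⟨P, Q, hPQ⟩ := exists_ordProd_update δ hs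
  have h : ordProd (Function.update δ s (∑ i ∈ L, a i • δ i)) S =
      ∑ i ∈ L, a i • ordProd (Function.update δ s (δ i)) S := by
    simp only [hPQ, Finset.mul_sum, Finset.sum_mul, mul_smul_comm, smul_mul_assoc]
  rw [h, ← Finset.sum_sdiff hSL, add_comm]
  congr 1
  -- For `r ∈ S` other than `s`, the factor `δ r` occurs twice and the product vanishes.
  rw [Finset.sum_eq_single s, Function.update_eq_self]
  · intro r hr hrs
    rw [ordProd_update_eq_zero hδ hδ0 hs hr hrs, smul_zero]
  · exact fun h => absurd hs h

/-- With `Uᵢ = τᵢ δᵢ`, the defining expression of `P_{L,S}` is a combination of products of `τᵢ` and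
`Uᵢ` only. -/
theorem relation_identity (τ : Fin m → R) {δ : Fin m → A}
    (hδ : ∀ i j, δ i * δ j + δ j * δ i = 0) (hδ0 : ∀ i, δ i * δ i = 0) (a : Fin m → F)
    {S L : Finset (Fin m)} (hSL : S ⊆ L) :
    ∑ r ∈ L \ S, a r • (∏ i ∈ L \ insert r S, τ i) • (ordProd (fun i => τ i • δ i) S -
        ∑ s ∈ S, ordProd (Function.update (fun i => τ i • δ i) s (τ r • δ r)) S) =
      (∑ r ∈ L, a r • ∏ i ∈ L.erase r, τ i) • ordProd δ S -
        ∑ s ∈ S, (∏ i ∈ L.erase s, τ i) •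
          ordProd (Function.update δ s (∑ i ∈ L, a i • δ i)) S := by
  have h1 : ∀ r ∈ L \ S, (∏ i ∈ L \ insert r S, τ i) • ordProd (fun i => τ i • δ i) S =
      (∏ i ∈ L.erase r, τ i) • ordProd δ S := fun r hr => by
    rw [ordProd_smul, smul_smul]
    congr 1
    rw [Finset.mem_sdiff] at hr
    have : S ⊆ L.erase r := fun i hi => Finset.mem_erase.2 ⟨fun e => hr.2 (e ▸ hi), hSL hi⟩
    rw [← Finset.prod_sdiff this]
    congr 2
    ext i; simp only [Finset.mem_sdiff, Finset.mem_insert, Finset.mem_erase]; tauto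
  have h2 : ∀ r ∈ L \ S, ∀ s ∈ S, (∏ i ∈ L \ insert r S, τ i) •
      ordProd (Function.update (fun i => τ i • δ i) s (τ r • δ r)) S =
      (∏ i ∈ L.erase s, τ i) • ordProd (Function.update δ s (δ r)) S := fun r hr s hs => by
    rw [Finset.mem_sdiff] at hr
    have e : Function.update (fun i => τ i • δ i) s (τ r • δ r) =
        fun i => Function.update τ s (τ r) i • Function.update δ s (δ r) i := by
      funext i
      by_cases h : i = s
      · subst h; simp
      · simp [h]
    rw [e, ordProd_smul, smul_smul, Finset.prod_update_of_mem hs, ← mul_assoc,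
      Finset.sdiff_singleton_eq_erase]
    congr 1
    -- Replacing `s` by `r` in `S` leaves exactly the factors `τ i` with `i ∈ L \ (S ∪ r)` unused.
    have hd : L.erase s = (L \ insert r S) ∪ (insert r (S.erase s)) := by
      ext i
      simp only [Finset.mem_erase, Finset.mem_union, Finset.mem_sdiff, Finset.mem_insert]
      by_cases his : i = s
      · subst his
        have : i ≠ r := fun e => hr.2 (e ▸ hs)
        tauto
      · by_cases hir : i = r
        · subst hir; tauto
        · have := @hSL i
          tauto
    rw [hd, Finset.prod_union, Finset.prod_insert, mul_assoc]
    · exact fun h => hr.2 (Finset.mem_of_mem_erase h)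
    · rw [Finset.disjoint_left]
      intro i hi hi'
      simp only [Finset.mem_sdiff, Finset.mem_insert, Finset.mem_erase] at hi hi'
      tauto
  have hL : ∑ r ∈ L \ S, a r • (∏ i ∈ L \ insert r S, τ i) • (ordProd (fun i => τ i • δ i) S -
        ∑ s ∈ S, ordProd (Function.update (fun i => τ i • δ i) s (τ r • δ r)) S) =
      ∑ r ∈ L \ S, a r • (∏ i ∈ L.erase r, τ i) • ordProd δ S -
      ∑ s ∈ S, (∏ i ∈ L.erase s, τ i) • ∑ r ∈ L \ S,
        a r • ordProd (Function.update δ s (δ r)) S := by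
    simp only [Finset.smul_sum]
    rw [Finset.sum_comm, ← Finset.sum_sub_distrib]
    refine Finset.sum_congr rfl fun r hr => ?_
    rw [smul_sub, smul_sub, h1 r hr, Finset.smul_sum, Finset.smul_sum]
    congr 1
    refine Finset.sum_congr rfl fun s hs => ?_
    rw [h2 r hr s hs]
    exact (smul_algebra_smul_comm _ _ _).symm
  have h4 : ∑ s ∈ S, (∏ i ∈ L.erase s, τ i) •
      ordProd (Function.update δ s (∑ i ∈ L, a i • δ i)) S =
      ∑ s ∈ S, (∏ i ∈ L.erase s, τ i) • a s • ordProd δ S + ∑ s ∈ S, (∏ i ∈ L.erase s, τ i) •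
        ∑ r ∈ L \ S, a r • ordProd (Function.update δ s (δ r)) S := by
    rw [← Finset.sum_add_distrib]
    refine Finset.sum_congr rfl fun s hs => ?_
    rw [ordProd_update_sum hδ hδ0 a hs hSL, smul_add]
  have h3 : ∑ s ∈ S, (∏ i ∈ L.erase s, τ i) • a s • ordProd δ S =
      ∑ s ∈ S, a s • (∏ i ∈ L.erase s, τ i) • ordProd δ S :=
    Finset.sum_congr rfl fun s _ => smul_algebra_smul_comm _ _ _
  -- The summands `r ∈ S` of the first term cancel against the summands `r = s` of the expanded
  -- `dL`.
  rw [hL, h4, h3, ← Finset.sum_sdiff hSL, add_smul, Finset.sum_smul, Finset.sum_smul]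
  simp only [smul_assoc]
  abel

end OrderedProducts

/-! ### The elements `P_{L,S}` lie in `F[t] ⊗ Λ[u]` and in the kernel of `ψ` -/

section Relations

variable {F : Type*} [Field F] {n m : ℕ}

theorem mem_supp {a : Fin m → F} {i : Fin m} : i ∈ supp a ↔ a i ≠ 0 := by
  simp [supp]

theorem linForm_sum_smul {ι : Type*} (s : Finset ι) (a : ι → F) (c : ι → Fin n → F) :
    linForm (∑ i ∈ s, a i • c i) = ∑ i ∈ s, a i • linForm (c i) := by
  simp only [linForm, Finset.sum_apply, Pi.smul_apply, smul_eq_mul, map_sum, Finset.sum_mul,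
    map_mul, Finset.smul_sum, MvPolynomial.smul_eq_C_mul, mul_assoc]
  exact Finset.sum_comm

theorem linForm_eq_zero_iff {v : Fin n → F} : linForm v = 0 ↔ v = 0 := by
  refine ⟨fun h => ?_, fun h => by simp [h, linForm]⟩
  funext j
  have := congrArg (MvPolynomial.eval (Pi.single j 1 : Fin n → F)) h
  simpa [linForm, Pi.single_apply] using this

theorem isRelation_iff {c : Fin m → Fin n → F} {a : Fin m → F} :
    IsRelation c a ↔ a ≠ 0 ∧ ∑ i, a i • c i = 0 := by
  rw [IsRelation, ← linForm_sum_smul, linForm_eq_zero_iff]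

theorem sum_supp {M : Type*} [AddCommGroup M] [Module F M] (a : Fin m → F) (f : Fin m → M) :
    ∑ i ∈ supp a, a i • f i = ∑ i, a i • f i :=
  Finset.sum_subset (Finset.subset_univ _) fun i _ hi => by
    rw [mem_supp, not_not] at hi
    rw [hi, zero_smul]

theorem toLoc_injective {z : Fin m → MvPolynomial (Fin n) F} (hz : ∀ i, z i ≠ 0) :
    Function.Injective (toLoc z) := by
  have hM : denominators z ≤ nonZeroDivisors (MvPolynomial (Fin n) F) := by
    rw [Submonoid.closure_le]
    rintro _ ⟨i, rfl⟩
    exact mem_nonZeroDivisors_of_ne_zero (hz i)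
  have h := IsLocalization.injective (Localization (denominators z)) hM
  -- The exterior algebra is flat over the field `F`, so injectivity survives the tensor product.
  exact Module.Flat.rTensor_preserves_injective_linearMap (M := ExteriorAlgebra F (Fin n → F))
    (IsScalarTower.toAlgHom F (MvPolynomial (Fin n) F) (Localization (denominators z))).toLinearMap
    h

/-- The odd generator `uᵢ` of the exterior algebra. -/
abbrev oddGen (F : Type*) [Field F] {m : ℕ} (i : Fin m) : ExteriorAlgebra F (Fin m → F) :=
  ExteriorAlgebra.ι F (Pi.single i 1)

/-- The element `P_{L,S}` of `F[t] ⊗ Λ[u]`. -/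
def relLift (a : Fin m → F) (S : Finset (Fin m)) : SuperPoly F m :=
  ∑ r ∈ supp a \ S, a r • ((∏ i ∈ supp a \ insert r S, MvPolynomial.X i) ⊗ₜ[F]
    (ordProd (oddGen F) S - ∑ s ∈ S, ordProd (Function.update (oddGen F) s (oddGen F r)) S))

variable {R A : Type*} [CommRing R] [Ring A] [Algebra R A] [Algebra F A]

theorem map_prod_X (Θ : SuperPoly F m →ₐ[F] A) {τ : Fin m → R}
    (hτ : ∀ i, Θ (t F i) = algebraMap R A (τ i)) (I : Finset (Fin m)) :
    Θ ((∏ i ∈ I, MvPolynomial.X i) ⊗ₜ[F] 1) = algebraMap R A (∏ i ∈ I, τ i) := by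
  induction I using Finset.induction_on with
  | empty =>
    rw [Finset.prod_empty, Finset.prod_empty, map_one, ← Algebra.TensorProduct.one_def, map_one]
  | insert k I hk ih =>
    rw [Finset.prod_insert hk, Finset.prod_insert hk, map_mul, ← hτ, ← ih, ← map_mul, t,
      Algebra.TensorProduct.tmul_mul_tmul, one_mul]

theorem map_one_tmul_ordProd (Θ : SuperPoly F m →ₐ[F] A)
    (f : Fin m → ExteriorAlgebra F (Fin m → F)) (S : Finset (Fin m)) :
    Θ (1 ⊗ₜ[F] ordProd f S) = ordProd (fun i => Θ (1 ⊗ₜ[F] f i)) S :=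
  map_ordProd (Θ.comp Algebra.TensorProduct.includeRight).toRingHom f S

/-- Stated for an arbitrary target because it is needed twice: in the localization of `F[t] ⊗ Λ[u]`,
to identify `relLift` with `P_{L,S}`, and in `T`, to see that `ψ` kills it. -/
theorem map_relLift [Algebra F R] [IsScalarTower F R A] (Θ : SuperPoly F m →ₐ[F] A) {τ : Fin m → R} {δ : Fin m → A}
    (hτ : ∀ i, Θ (t F i) = algebraMap R A (τ i)) (hu : ∀ i, Θ (u F i) = τ i • δ i)
    (hδ : ∀ i j, δ i * δ j + δ j * δ i = 0) (hδ0 : ∀ i, δ i * δ i = 0) (a : Fin m → F)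
    {S : Finset (Fin m)} (hS : S ⊆ supp a) :
    Θ (relLift a S) =
      (∑ r ∈ supp a, a r • ∏ i ∈ (supp a).erase r, τ i) • ordProd δ S -
        ∑ s ∈ S, (∏ i ∈ (supp a).erase s, τ i) •
          ordProd (Function.update δ s (∑ i ∈ supp a, a i • δ i)) S := by
  rw [← relation_identity τ hδ hδ0 a hS, relLift, map_sum]
  refine Finset.sum_congr rfl fun r _ => ?_
  have hu' : ∀ i, Θ (1 ⊗ₜ[F] oddGen F i) = τ i • δ i := hu
  have e : ∀ s, (fun i => Θ (1 ⊗ₜ[F] Function.update (oddGen F) s (oddGen F r) i)) =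
      Function.update (fun i => τ i • δ i) s (τ r • δ r) := fun s => by
    funext i
    by_cases h : i = s
    · subst h; simp [hu']
    · simp [h, hu']
  have e' : ∀ (p : MvPolynomial (Fin m) F) (w : ExteriorAlgebra F (Fin m → F)),
      p ⊗ₜ[F] w = (p ⊗ₜ[F] 1 : SuperPoly F m) * (1 ⊗ₜ[F] w) := fun p w => by simp
  rw [map_smul, e', map_mul, map_prod_X Θ hτ, ← Algebra.smul_def, TensorProduct.tmul_sub,
    TensorProduct.tmul_sum, map_sub, map_sum, map_one_tmul_ordProd]
  simp only [map_one_tmul_ordProd, hu', e]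

theorem map_relLift_eq_mul_sub [Algebra F R] [IsScalarTower F R A] (Θ : SuperPoly F m →ₐ[F] A)
    {τ : Fin m → R} {δ : Fin m → A}
    (hτ : ∀ i, Θ (t F i) = algebraMap R A (τ i)) (hu : ∀ i, Θ (u F i) = τ i • δ i)
    (hδ : ∀ i j, δ i * δ j + δ j * δ i = 0) (hδ0 : ∀ i, δ i * δ i = 0) (a : Fin m → F)
    {S : Finset (Fin m)} (hS : S ⊆ supp a) :
    Θ (relLift a S) = Θ (relPoly a) * ordProd δ S -
      ∑ s ∈ S, Θ (tProd F ((supp a).erase s)) *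
        ordProd (Function.update δ s (∑ i ∈ supp a, a i • δ i)) S := by
  have h1 : ∀ I : Finset (Fin m), Θ (tProd F I) = algebraMap R A (∏ i ∈ I, τ i) :=
    map_prod_X Θ hτ
  rw [map_relLift Θ hτ hu hδ hδ0 a hS]
  congr 1
  · rw [Algebra.smul_def, relPoly, map_sum, map_sum]
    congr 1
    refine Finset.sum_congr rfl fun r _ => ?_
    rw [map_smul Θ, h1, Algebra.smul_def, map_mul, Algebra.smul_def,
      ← IsScalarTower.algebraMap_apply]
  · exact Finset.sum_congr rfl fun s _ => by rw [h1, Algebra.smul_def]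

theorem map_relLift_eq_zero [Algebra F R] [IsScalarTower F R A] (Θ : SuperPoly F m →ₐ[F] A)
    {τ ζ : Fin m → R} {δ : Fin m → A}
    (hτ : ∀ i, Θ (t F i) = algebraMap R A (τ i)) (hu : ∀ i, Θ (u F i) = τ i • δ i)
    (hδ : ∀ i j, δ i * δ j + δ j * δ i = 0) (hδ0 : ∀ i, δ i * δ i = 0) (a : Fin m → F)
    {S : Finset (Fin m)} (hS : S ⊆ supp a) (hζ : ∀ i, τ i * ζ i = 1)
    (haζ : ∑ i ∈ supp a, a i • ζ i = 0) (haδ : ∑ i ∈ supp a, a i • δ i = 0) :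
    Θ (relLift a S) = 0 := by
  -- With `ζ` inverse to `τ`, the image of `P_L` is `∏ τ i` times the relation among the `ζ i`.
  have h2 : ∑ r ∈ supp a, a r • ∏ i ∈ (supp a).erase r, τ i = 0 := by
    have : ∀ r ∈ supp a, a r • ∏ i ∈ (supp a).erase r, τ i =
        (∏ i ∈ supp a, τ i) * a r • ζ r := fun r hr => by
      rw [← Finset.mul_prod_erase _ _ hr, mul_right_comm, mul_smul_comm, hζ, smul_mul_assoc,
        one_mul]
    rw [Finset.sum_congr rfl this, ← Finset.mul_sum, haζ, mul_zero]
  rw [map_relLift Θ hτ hu hδ hδ0 a hS, haδ, h2, zero_smul, zero_sub, neg_eq_zero]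
  refine Finset.sum_eq_zero fun s hs => ?_
  obtain ⟨P, Q, hPQ⟩ := exists_ordProd_update δ hs
  rw [hPQ, mul_zero, zero_mul, smul_zero]

theorem zInv_eq_algebraMap (z : Fin m → MvPolynomial (Fin n) F) (i : Fin m) :
    zInv z i = algebraMap (Localization (denominators z)) (SuperLoc z)
      (Localization.mk 1 ⟨z i, Submonoid.subset_closure (Set.mem_range_self i)⟩) := rfl

theorem mk_one_mul_algebraMap (z : Fin m → MvPolynomial (Fin n) F) (i : Fin m) :
    (Localization.mk 1 ⟨z i, Submonoid.subset_closure (Set.mem_range_self i)⟩ :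
      Localization (denominators z)) * algebraMap _ _ (z i) = 1 := by
  rw [Localization.mk_eq_mk', mul_comm]
  simp

theorem toXiLoc_relLift (a : Fin m → F) {S : Finset (Fin m)} (hS : S ⊆ supp a) :
    toXiLoc F m (relLift a S) = relElt a S := by
  let Rl := Localization (denominators (MvPolynomial.X : Fin m → MvPolynomial (Fin m) F))
  let τ : Fin m → Rl := fun i => algebraMap (MvPolynomial (Fin m) F) Rl (MvPolynomial.X i)
  have hτ : ∀ i, toXiLoc F m (t F i) = algebraMap Rl _ (τ i) := fun i => by
    rw [Algebra.TensorProduct.algebraMap_apply]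
    simp [toLoc, t, τ, Rl]
  have hu : ∀ i, toXiLoc F m (u F i) = 1 ⊗ₜ[F] oddGen F i := fun i => by
    simp [toLoc, u]
  have hdz : ∀ i, dz F i = (Localization.mk 1 ⟨MvPolynomial.X i,
      Submonoid.subset_closure (Set.mem_range_self i)⟩ : Rl) ⊗ₜ[F] oddGen F i := fun i => by
    rw [dz, hu, zInv, Algebra.TensorProduct.tmul_mul_tmul, mul_one, one_mul]
  have hu' : ∀ i, toXiLoc F m (u F i) = τ i • dz F i := fun i => by
    rw [hdz, hu, TensorProduct.smul_tmul', smul_eq_mul, mul_comm (τ i), mk_one_mul_algebraMap]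
  refine map_relLift_eq_mul_sub (R := Rl) (A := XiLoc F m) (τ := τ) (δ := dz F) (toXiLoc F m)
    hτ hu' ?_ ?_ a hS
  · intro i j
    rw [hdz, hdz, Algebra.TensorProduct.tmul_mul_tmul, Algebra.TensorProduct.tmul_mul_tmul,
      mul_comm (Localization.mk 1 ⟨MvPolynomial.X j, _⟩), ← TensorProduct.tmul_add,
      ExteriorAlgebra.ι_add_mul_swap, TensorProduct.tmul_zero]
  · intro i
    rw [hdz, Algebra.TensorProduct.tmul_mul_tmul, ExteriorAlgebra.ι_sq_zero,
      TensorProduct.tmul_zero]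

theorem existsUnique_toXiLoc_eq_relElt (a : Fin m → F) {S : Finset (Fin m)} (hS : S ⊆ supp a) :
    ∃! p : SuperPoly F m, toXiLoc F m p = relElt a S :=
  ⟨relLift a S, toXiLoc_relLift a hS, fun _ hq =>
    toLoc_injective (fun i => MvPolynomial.X_ne_zero i) (hq.trans (toXiLoc_relLift a hS).symm)⟩

theorem form_mul_form_add (z : Fin m → MvPolynomial (Fin n) F) (v w : Fin n → F) :
    form z v * form z w + form z w * form z v = 0 := by
  simp only [form, Algebra.TensorProduct.tmul_mul_tmul, mul_one]
  rw [← TensorProduct.tmul_add, ExteriorAlgebra.ι_add_mul_swap, TensorProduct.tmul_zero]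

theorem form_mul_self (z : Fin m → MvPolynomial (Fin n) F) (v : Fin n → F) :
    form z v * form z v = 0 := by
  simp [form]

theorem psi_relLift {c : Fin m → Fin n → F} {a : Fin m → F} (ha : IsRelation c a)
    {S : Finset (Fin m)} (hS : S ⊆ supp a) : psi c (relLift a S) = 0 := by
  let Rl := Localization (denominators (forms c))
  let τ : Fin m → Rl := fun i =>
    Localization.mk 1 ⟨forms c i, Submonoid.subset_closure (Set.mem_range_self i)⟩
  have hτ : ∀ i, psi c (t F i) = algebraMap Rl _ (τ i) := fun i => psi_t c i
  have hu : ∀ i, psi c (u F i) = τ i • form (forms c) (c i) := fun i => by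
    rw [psi_u, dlog, zInv_eq_algebraMap, ← Algebra.smul_def]
  refine map_relLift_eq_zero (R := Rl) (A := SuperLoc (forms c)) (τ := τ)
    (ζ := fun i => algebraMap _ Rl (forms c i)) (δ := fun i => form (forms c) (c i)) (psi c) hτ hu
    (fun i j => form_mul_form_add _ _ _) (fun i => form_mul_self _ _) a hS
    (mk_one_mul_algebraMap (forms c)) ?_ ?_
  · have h := congrArg (IsScalarTower.toAlgHom F (MvPolynomial (Fin n) F) Rl) ha.2
    rw [map_sum, map_zero] at h
    rw [sum_supp, ← h]
    exact Finset.sum_congr rfl fun i _ =>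
      (map_smul (IsScalarTower.toAlgHom F (MvPolynomial (Fin n) F) Rl) (a i) _).symm
  · simp only [form, ← TensorProduct.tmul_smul, ← TensorProduct.tmul_sum, ← map_smul, ← map_sum]
    rw [sum_supp, (isRelation_iff.1 ha).2, map_zero, TensorProduct.tmul_zero]

theorem relLift_mem_relSet {c : Fin m → Fin n → F} {a : Fin m → F} (ha : IsRelation c a)
    {S : Finset (Fin m)} (hS : S ⊆ supp a) : relLift a S ∈ relSet c :=
  ⟨a, S, ha, hS, toXiLoc_relLift a hS⟩

theorem span_relSet_le_ker (c : Fin m → Fin n → F) :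
    TwoSidedIdeal.span (relSet c) ≤ TwoSidedIdeal.ker (psi c) := by
  rw [TwoSidedIdeal.span_le]
  rintro p ⟨a, S, ha, hS, hp⟩
  rw [(existsUnique_toXiLoc_eq_relElt a hS).unique hp (toXiLoc_relLift a hS)]
  exact (TwoSidedIdeal.mem_ker _).2 (psi_relLift ha hS)

end Relations

/-! ### Linear independence of the standard monomials in `T` -/

section Independence

variable {F : Type*} [Field F] {n m : ℕ}

/-- The set `B` contains no set `|L| \ {max |L|}`, where `L` is a relation with `|L| ⊆ I`: a
variant of the condition that `B` contains no broken circuit. -/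
def IsStd (c : Fin m → Fin n → F) (I B : Finset (Fin m)) : Prop :=
  ∀ a : Fin m → F, supp a ⊆ I → ∑ i, a i • c i = 0 →
    ∀ j ∈ supp a, (∀ i ∈ supp a, i ≤ j) → ¬ (supp a).erase j ⊆ B

/-- The multidegree of the monomial `t ^ x.1 * u_{x.2}`. -/
def monoDeg (x : (Fin m → ℕ) × Finset (Fin m)) (i : Fin m) : ℕ :=
  x.1 i + if i ∈ x.2 then 1 else 0

/-- The set of the indices that occur in the monomial `t ^ x.1 * u_{x.2}`. -/
def monoSupp (x : (Fin m → ℕ) × Finset (Fin m)) : Finset (Fin m) :=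
  Finset.univ.filter fun i => monoDeg x i ≠ 0

theorem mem_monoSupp {x : (Fin m → ℕ) × Finset (Fin m)} {i : Fin m} :
    i ∈ monoSupp x ↔ monoDeg x i ≠ 0 := by
  simp [monoSupp]

/-- The image in `T` of the part in `I` of the monomial `t ^ x.1 * u_{x.2}`, multiplied by the
denominator `∏ i ∈ I, zᵢ ^ e i`. -/
def clearedMono (c : Fin m → Fin n → F) (I : Finset (Fin m)) (e : Fin m → ℕ)
    (x : (Fin m → ℕ) × Finset (Fin m)) : SuperPoly F n :=
  (∏ i ∈ I, linForm (c i) ^ (e i - monoDeg x i)) ⊗ₜ[F]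
    ordProd (fun i => ExteriorAlgebra.ι F (c i)) (x.2 ∩ I)

/-- The monomials of `s` have distinct parts in `I`, and these are standard and of multidegree at
most `e`. -/
structure IsStdFamily (c : Fin m → Fin n → F) (I : Finset (Fin m)) (e : Fin m → ℕ)
    (s : Finset ((Fin m → ℕ) × Finset (Fin m))) : Prop where
  eq_of_agree : ∀ x ∈ s, ∀ y ∈ s, (∀ i ∈ I, x.1 i = y.1 i) → (∀ i ∈ I, i ∈ x.2 ↔ i ∈ y.2) → x = y
  deg_le : ∀ x ∈ s, ∀ i ∈ I, monoDeg x i ≤ e i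
  isStd : ∀ x ∈ s, IsStd c I (monoSupp x)

/-- Standard monomials supported in `I` have linearly independent images. -/
def StdIndep (F : Type*) [Field F] (n : ℕ) (I : Finset (Fin m)) : Prop :=
  ∀ (c : Fin m → Fin n → F) (e : Fin m → ℕ) (s : Finset ((Fin m → ℕ) × Finset (Fin m)))
    (f : (Fin m → ℕ) × Finset (Fin m) → F), IsStdFamily c I e s →
    ∑ x ∈ s, f x • clearedMono c I e x = 0 → ∀ x ∈ s, f x = 0

theorem IsStd.mono {c : Fin m → Fin n → F} {I J B : Finset (Fin m)} (h : IsStd c J B)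
    (hIJ : I ⊆ J) : IsStd c I B :=
  fun a ha => h a (ha.trans hIJ)

/-- If `c k = 0`, then `z_k = 0` is a relation whose set `|L| \ {max |L|}` is empty, hence contained
in every `B`. -/
theorem IsStd.ne_zero {c : Fin m → Fin n → F} {I B : Finset (Fin m)} (h : IsStd c I B)
    {k : Fin m} (hk : k ∈ I) : c k ≠ 0 := by
  intro h0
  have hs : supp (Pi.single k 1 : Fin m → F) = {k} := by
    ext i
    rw [mem_supp, Finset.mem_singleton]
    by_cases h : i = k
    · subst h; simp
    · simp [h]
  refine h (Pi.single k 1) (by simpa [hs]) ?_ k (by simp [hs]) (by simp [hs]) (by simp [hs])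
  rw [Finset.sum_eq_single k (fun i _ hi => by simp [hi]) (by simp), h0, smul_zero]

/-- A relation among the projected vectors lifts to one among the `c i` by adding a multiple of `c
k`. As `k` lies below `I`, the maximum of the support does not change, and the possible new index
`k` already lies in `B`. -/
theorem IsStd.project {c : Fin m → Fin n → F} {I B : Finset (Fin m)} {k : Fin m}
    (h : IsStd c (insert k I) B) (hk : ∀ i ∈ I, k < i) (hkB : k ∈ B)
    {q : (Fin n → F) →ₗ[F] (Fin n → F)} (hq : ∀ v, q v = 0 → ∃ r : F, v = r • c k) :
    IsStd (fun i => q (c i)) I B := by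
  intro a ha ha0 j hj hmax hB
  obtain ⟨r, hr⟩ := hq (∑ i, a i • c i) (by simpa using ha0)
  have hkI : k ∉ I := fun hk' => lt_irrefl _ (hk k hk')
  have hka : a k = 0 := by
    by_contra hne
    exact hkI (ha (mem_supp.2 hne))
  let a' : Fin m → F := Function.update a k (-r)
  have ha' : ∀ i, i ≠ k → a' i = a i := fun i hi => Function.update_of_ne hi _ _
  have hsub : ∀ i ∈ supp a', i = k ∨ i ∈ supp a := fun i hi => by
    by_cases hik : i = k
    · exact Or.inl hik
    · exact Or.inr (by rwa [mem_supp, ← ha' i hik, ← mem_supp])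
  have hjk : j ≠ k := fun e => hkI (e ▸ ha hj)
  refine h a' ?_ ?_ j ?_ ?_ ?_
  · intro i hi
    rcases hsub i hi with rfl | hi
    · exact Finset.mem_insert_self _ _
    · exact Finset.mem_insert_of_mem (ha hi)
  · have : ∑ i, a' i • c i = ∑ i, a i • c i + (-r) • c k := by
      have h1 : ∀ i, a' i • c i = a i • c i + if i = k then (-r) • c k else 0 := fun i => by
        by_cases hik : i = k
        · subst hik; simp [a', hka]
        · simp [ha' i hik, hik]
      rw [Finset.sum_congr rfl fun i _ => h1 i, Finset.sum_add_distrib]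
      simp
    rw [this, hr, neg_smul, add_neg_cancel]
  · rw [mem_supp, ha' j hjk, ← mem_supp]
    exact hj
  · intro i hi
    rcases hsub i hi with rfl | hi
    · exact (hk j (ha hj)).le
    · exact hmax i hi
  · intro i hi
    rw [Finset.mem_erase] at hi
    rcases hsub i hi.2 with rfl | hi'
    · exact hkB
    · exact hB (Finset.mem_erase.2 ⟨hi.1, hi'⟩)

/-- The endomorphism of `F[x]` that extends a linear map of linear forms. -/
def polyMap (q : (Fin n → F) →ₗ[F] (Fin n → F)) :
    MvPolynomial (Fin n) F →ₐ[F] MvPolynomial (Fin n) F :=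
  MvPolynomial.aeval fun j => linForm (q (Pi.single j 1))

theorem polyMap_linForm (q : (Fin n → F) →ₗ[F] (Fin n → F)) (v : Fin n → F) :
    polyMap q (linForm v) = linForm (q v) := by
  conv_rhs => rw [pi_eq_sum_univ' v, map_sum]
  simp only [map_smul, linForm_sum_smul]
  simp [linForm, polyMap, MvPolynomial.smul_eq_C_mul, MvPolynomial.algebraMap_eq]

theorem exists_projection {v : Fin n → F} (hv : v ≠ 0) :
    ∃ (φ : Module.Dual F (Fin n → F)) (q : (Fin n → F) →ₗ[F] (Fin n → F)),
      φ v = 1 ∧ q v = 0 ∧ ∀ w, q w = 0 → ∃ r : F, w = r • v := by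
  obtain ⟨j, hj⟩ := Function.ne_iff.1 hv
  let φ : Module.Dual F (Fin n → F) := (v j)⁻¹ • LinearMap.proj j
  have h : φ v = 1 := by simpa [φ] using inv_mul_cancel₀ hj
  refine ⟨φ, LinearMap.id - φ.smulRight v, h, by simp [h], fun w hw => ⟨φ w, ?_⟩⟩
  simpa [sub_eq_zero] using hw

theorem polyMap_prod (q : (Fin n → F) →ₗ[F] (Fin n → F)) (c : Fin m → Fin n → F)
    (I : Finset (Fin m)) (d : Fin m → ℕ) :
    polyMap q (∏ i ∈ I, linForm (c i) ^ d i) = ∏ i ∈ I, linForm (q (c i)) ^ d i := by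
  simp only [map_prod, map_pow, polyMap_linForm]

/-- Setting `z_k = 0` kills all terms that keep a positive power of `z_k` after clearing
denominators, leaving those of degree exactly `e k`. Since `e k ≠ 0`, their supports contain `k`, as
`IsStd.project` requires. They are treated in two families, without and with `u_k`, because within
each family the degree determines the exponent of `t_k`. -/
theorem coeff_eq_zero_of_deg_eq {I : Finset (Fin m)} (hI : StdIndep F n I) {k : Fin m}
    (hk : ∀ i ∈ I, k < i) {c : Fin m → Fin n → F} {e : Fin m → ℕ}
    {s : Finset ((Fin m → ℕ) × Finset (Fin m))} (hs : IsStdFamily c (insert k I) e s)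
    (f : (Fin m → ℕ) × Finset (Fin m) → F)
    (h : ∑ x ∈ s, f x • clearedMono c (insert k I) e x = 0) (hek : e k ≠ 0) :
    ∀ x ∈ s, monoDeg x k = e k → f x = 0 := by
  intro x₀ hx₀ hdx₀
  have hkI : k ∉ I := fun hk' => lt_irrefl _ (hk k hk')
  have hck : c k ≠ 0 := (hs.isStd x₀ hx₀).ne_zero (Finset.mem_insert_self _ _)
  obtain ⟨φ, q, hφ, hqk, hq⟩ := exists_projection hck
  have hfam : ∀ s' ⊆ s, (∀ x ∈ s', ∀ y ∈ s', x.1 k = y.1 k) →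
      (∀ x ∈ s', ∀ y ∈ s', k ∈ x.2 ↔ k ∈ y.2) → (∀ x ∈ s', monoDeg x k = e k) →
      IsStdFamily (fun i => q (c i)) I e s' := fun s' hs' h1 h2 h3 =>
    { eq_of_agree := fun x hx y hy hxy hxy' => by
        refine hs.eq_of_agree x (hs' hx) y (hs' hy) ?_ ?_ <;> intro i hi <;>
          rcases Finset.mem_insert.1 hi with rfl | hi
        exacts [h1 x hx y hy, hxy i hi, h2 x hx y hy, hxy' i hi]
      deg_le := fun x hx i hi => hs.deg_le x (hs' hx) i (Finset.mem_insert_of_mem hi)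
      isStd := fun x hx => (hs.isStd x (hs' hx)).project hk
        (mem_monoSupp.2 (by rwa [h3 x hx])) hq }
  have hpoly : ∀ x ∈ s, polyMap q (∏ i ∈ insert k I, linForm (c i) ^ (e i - monoDeg x i)) =
      if monoDeg x k = e k then ∏ i ∈ I, linForm (q (c i)) ^ (e i - monoDeg x i) else 0 :=
    fun x hx => by
    rw [polyMap_prod q c _ (fun i => e i - monoDeg x i), Finset.prod_insert hkI, hqk,
      linForm_eq_zero_iff.2 rfl]
    split_ifs with hd
    · rw [hd, Nat.sub_self, pow_zero, one_mul]
    · have := hs.deg_le x hx k (Finset.mem_insert_self _ _)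
      rw [zero_pow (by omega), zero_mul]
  have hord : ∀ S, ExteriorAlgebra.map q (ordProd (fun i => ExteriorAlgebra.ι F (c i)) S) =
      ordProd (fun i => ExteriorAlgebra.ι F (q (c i))) S := fun S => by
    have := map_ordProd (ExteriorAlgebra.map q).toRingHom (fun i => ExteriorAlgebra.ι F (c i)) S
    simpa using this
  have hins : ∀ S : Finset (Fin m), k ∈ S →
      ordProd (fun i => ExteriorAlgebra.ι F (c i)) (S ∩ insert k I) =
        ExteriorAlgebra.ι F (c k) * ordProd (fun i => ExteriorAlgebra.ι F (c i)) (S ∩ I) :=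
    fun S hS => by
    rw [Finset.inter_insert_of_mem hS, ordProd_insert]
    exact fun i hi => hk i (Finset.mem_inter.1 hi).2
  -- Restriction of forms to the hyperplane also kills `dz_k`, so only the terms without `u_k`
  -- remain.
  have hzero : ∀ x ∈ s, monoDeg x k = e k → k ∉ x.2 → f x = 0 := by
    let s' := s.filter fun x => monoDeg x k = e k ∧ k ∉ x.2
    have hs' : ∀ x, x ∈ s' ↔ x ∈ s ∧ monoDeg x k = e k ∧ k ∉ x.2 := fun x => Finset.mem_filter
    have hsum := congrArg (Algebra.TensorProduct.map (polyMap q) (ExteriorAlgebra.map q)) h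
    rw [map_sum, map_zero] at hsum
    have key : ∑ x ∈ s', f x • clearedMono (fun i => q (c i)) I e x = 0 := by
      rw [← hsum, Finset.sum_filter]
      refine Finset.sum_congr rfl fun x hx => ?_
      rw [map_smul, clearedMono.eq_def c, Algebra.TensorProduct.map_tmul, hpoly x hx]
      by_cases hd : monoDeg x k = e k
      · by_cases hkx : k ∈ x.2
        · rw [if_neg (by tauto), hins _ hkx, map_mul, ExteriorAlgebra.map_apply_ι, hqk, map_zero,
            zero_mul, TensorProduct.tmul_zero, smul_zero]
        · rw [if_pos ⟨hd, hkx⟩, if_pos hd, Finset.inter_insert_of_notMem hkx, hord, clearedMono]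
      · rw [if_neg (by tauto), if_neg hd, TensorProduct.zero_tmul, smul_zero]
    have := hI _ e s' f (hfam s' (Finset.filter_subset _ _) ?_ ?_ ?_) key
    · exact fun x hx hd hkx => this x ((hs' x).2 ⟨hx, hd, hkx⟩)
    · intro x hx y hy
      rw [hs'] at hx hy
      have h1 := hx.2.1
      have h2 := hy.2.1
      simp only [monoDeg, if_neg hx.2.2, if_neg hy.2.2] at h1 h2
      omega
    · intro x hx y hy
      rw [hs'] at hx hy
      tauto
    · intro x hx
      exact ((hs' x).1 hx).2.1
  by_cases hkx₀ : k ∈ x₀.2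
  swap
  · exact hzero x₀ hx₀ hdx₀ hkx₀
  let s' := s.filter fun x => monoDeg x k = e k ∧ k ∈ x.2
  have hs' : ∀ x, x ∈ s' ↔ x ∈ s ∧ monoDeg x k = e k ∧ k ∈ x.2 := fun x => Finset.mem_filter
  -- Contraction with `φ` before restricting strips off `dz_k`: it sends `dz_k w` to `w - dz_k (φ ⌟
  -- w)`, and `q` kills the second term.
  have hsum := congrArg (TensorProduct.map (polyMap q).toLinearMap
    ((ExteriorAlgebra.map q).toLinearMap ∘ₗ CliffordAlgebra.contractLeft φ)) h
  rw [map_sum, map_zero] at hsum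
  have key : ∑ x ∈ s', f x • clearedMono (fun i => q (c i)) I e x = 0 := by
    rw [← hsum, Finset.sum_filter]
    refine Finset.sum_congr rfl fun x hx => ?_
    rw [map_smul, clearedMono.eq_def c, TensorProduct.map_tmul, AlgHom.toLinearMap_apply, hpoly x hx]
    by_cases hd : monoDeg x k = e k
    · by_cases hkx : k ∈ x.2
      · have hc : CliffordAlgebra.contractLeft φ
            (ordProd (fun i => ExteriorAlgebra.ι F (c i)) (x.2 ∩ insert k I)) =
            φ (c k) • ordProd (fun i => ExteriorAlgebra.ι F (c i)) (x.2 ∩ I) -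
              ExteriorAlgebra.ι F (c k) * CliffordAlgebra.contractLeft φ
                (ordProd (fun i => ExteriorAlgebra.ι F (c i)) (x.2 ∩ I)) := by
          rw [hins _ hkx]
          exact CliffordAlgebra.contractLeft_ι_mul (Q := (0 : QuadraticForm F (Fin n → F)))
            φ (c k) _
        rw [if_pos ⟨hd, hkx⟩, if_pos hd, LinearMap.comp_apply, hc, AlgHom.toLinearMap_apply,
          map_sub, map_mul, ExteriorAlgebra.map_apply_ι, hqk, map_zero, zero_mul, sub_zero, hφ,
          one_smul, hord, clearedMono]
      -- The contraction need not kill terms without `u_k`, but their coefficients are already known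
      -- to vanish.
      · rw [if_neg (by tauto), hzero x hx hd hkx, zero_smul]
    · rw [if_neg (by tauto), if_neg hd, TensorProduct.zero_tmul, smul_zero]
  refine hI _ e s' f (hfam s' (Finset.filter_subset _ _) ?_ ?_ ?_) key x₀
    ((hs' x₀).2 ⟨hx₀, hdx₀, hkx₀⟩)
  · intro x hx y hy
    rw [hs'] at hx hy
    have h1 := hx.2.1
    have h2 := hy.2.1
    simp only [monoDeg, if_pos hx.2.2, if_pos hy.2.2] at h1 h2
    omega
  · intro x hx y hy
    rw [hs'] at hx hy
    tauto
  · intro x hx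
    exact ((hs' x).1 hx).2.1

theorem tmul_one_mul_injective {p : MvPolynomial (Fin n) F} (hp : p ≠ 0) {y : SuperPoly F n}
    (h : (p ⊗ₜ[F] 1 : SuperPoly F n) * y = 0) : y = 0 := by
  have hinj := Module.Flat.rTensor_preserves_injective_linearMap
    (M := ExteriorAlgebra F (Fin n → F)) (LinearMap.mulLeft F p) (mul_right_injective₀ hp)
  refine hinj ((Eq.trans ?_ h).trans (map_zero _).symm)
  clear h
  induction y using TensorProduct.induction_on with
  | zero => rw [map_zero, mul_zero]
  | tmul a w => simp
  | add y y' h h' => rw [map_add, mul_add, h, h']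

/-- Induction on `I`, adding a new smallest index `k`, and inside it on the pole order `e k`: the
top coefficients vanish, and the remaining sum can be divided by `z_k`. -/
theorem stdIndep (I : Finset (Fin m)) : StdIndep F n I := by
  induction I using Finset.induction_on_min with
  | empty =>
    intro c e s f hs h x hx
    have : s = {x} := Finset.eq_singleton_iff_unique_mem.2
      ⟨hx, fun y hy => hs.eq_of_agree y hy x hx (by simp) (by simp)⟩
    simpa [this, clearedMono, ordProd, ← Algebra.TensorProduct.one_def] using h
  | insert k I hk ih =>
    have hkI : k ∉ I := fun hk' => lt_irrefl _ (hk k hk')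
    intro c e s f hs h
    induction hp : e k generalizing e s with
    | zero =>
      -- No monomial involves `k`, so the hypothesis for `I` applies to the same vectors, without
      -- projection.
      have hd : ∀ x ∈ s, monoDeg x k = 0 := fun x hx => by
        have := hs.deg_le x hx k (Finset.mem_insert_self _ _)
        omega
      have hd' : ∀ x ∈ s, x.1 k = 0 ∧ k ∉ x.2 := fun x hx => by
        have := hd x hx
        rw [monoDeg] at this
        split_ifs at this with hkx
        exact ⟨this, hkx⟩
      refine ih c e s f ⟨fun x hx y hy hxy hxy' => ?_, fun x hx i hi =>
        hs.deg_le x hx i (Finset.mem_insert_of_mem hi), fun x hx =>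
        (hs.isStd x hx).mono (Finset.subset_insert _ _)⟩ ?_
      · have h1 := hd' x hx
        have h2 := hd' y hy
        refine hs.eq_of_agree x hx y hy ?_ ?_ <;> intro i hi <;>
          rcases Finset.mem_insert.1 hi with rfl | hi
        exacts [h1.1.trans h2.1.symm, hxy i hi, by tauto, hxy' i hi]
      · rw [← h]
        refine Finset.sum_congr rfl fun x hx => ?_
        rw [clearedMono, clearedMono, Finset.prod_insert hkI, hp, Nat.zero_sub, pow_zero, one_mul,
          Finset.inter_insert_of_notMem (hd' x hx).2]
    | succ p ihp =>
      have htop := coeff_eq_zero_of_deg_eq ih hk hs f h (by omega)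
      rw [hp] at htop
      let s' := s.filter fun x => monoDeg x k ≤ p
      have hs' : ∀ x, x ∈ s' ↔ x ∈ s ∧ monoDeg x k ≤ p := fun x => Finset.mem_filter
      let e' := Function.update e k p
      have he' : ∀ i, i ≠ k → e' i = e i := fun i hi => Function.update_of_ne hi _ _
      have hek : e' k = p := Function.update_self _ _ _
      have hlow : ∀ x ∈ s, ¬ monoDeg x k ≤ p → f x = 0 := fun x hx hd => htop x hx (by
        have := hs.deg_le x hx k (Finset.mem_insert_self _ _)
        omega)
      intro x₀ hx₀
      by_cases hd₀ : monoDeg x₀ k ≤ p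
      swap
      · exact hlow x₀ hx₀ hd₀
      have hck : c k ≠ 0 := (hs.isStd x₀ hx₀).ne_zero (Finset.mem_insert_self _ _)
      refine ihp e' s' ⟨fun x hx y hy => hs.eq_of_agree x ((hs' x).1 hx).1 y ((hs' y).1 hy).1,
        fun x hx i hi => ?_, fun x hx => hs.isStd x ((hs' x).1 hx).1⟩ ?_ hek x₀
        ((hs' x₀).2 ⟨hx₀, hd₀⟩)
      · by_cases hik : i = k
        · subst hik
          rw [hek]
          exact ((hs' x).1 hx).2
        · rw [he' i hik]
          exact hs.deg_le x ((hs' x).1 hx).1 i hi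
      -- The sum with the smaller bound `p` at `k`, multiplied by `z_k`, is the original sum.
      · refine tmul_one_mul_injective (mt linForm_eq_zero_iff.1 hck) ?_
        rw [← h, Finset.mul_sum, Finset.sum_filter]
        refine Finset.sum_congr rfl fun x hx => ?_
        split_ifs with hd
        · rw [mul_smul_comm, clearedMono, clearedMono, Algebra.TensorProduct.tmul_mul_tmul, one_mul,
            Finset.prod_insert hkI, Finset.prod_insert hkI, ← mul_assoc, ← pow_succ', hek, hp,
            Nat.sub_add_comm hd]
          congr 3
          refine Finset.prod_congr rfl fun i hi => ?_
          rw [he' i (ne_of_mem_of_not_mem hi hkI)]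
        · rw [hlow x hx hd, zero_smul]

end Independence

/-! ### Reduction to standard monomials modulo the relations -/

section Spanning

variable {F : Type*} [Field F] {n m : ℕ}

/-- The monomial `t ^ b * u_{l₁} ⋯ u_{lₖ}`. -/
def listMono (F : Type*) [Field F] {m : ℕ} (b : Fin m → ℕ) (l : List (Fin m)) : SuperPoly F m :=
  (∏ i, MvPolynomial.X i ^ b i) ⊗ₜ[F] (l.map (oddGen F)).prod

/-- The weight of a monomial, where `tᵢ` and `uᵢ` have weight `m - i`. -/
def monoWeight (b : Fin m → ℕ) (l : List (Fin m)) : ℕ :=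
  ∑ i, b i * (m - i) + (l.map fun i : Fin m => m - (i : ℕ)).sum

/-- The sum of the ideal of the relations and the span of the standard monomials. -/
def stdSpan (c : Fin m → Fin n → F) : Submodule F (SuperPoly F m) :=
  (TwoSidedIdeal.asIdeal (TwoSidedIdeal.span (relSet c))).restrictScalars F ⊔
    Submodule.span F ((fun x : (Fin m → ℕ) × Finset (Fin m) => listMono F x.1 x.2.sort) ''
      {x | IsStd c Finset.univ (monoSupp x)})

theorem mem_stdSpan_of_mem_span_relSet {c : Fin m → Fin n → F} {x : SuperPoly F m}
    (hx : x ∈ TwoSidedIdeal.span (relSet c)) : x ∈ stdSpan c :=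
  Submodule.mem_sup_left (TwoSidedIdeal.mem_asIdeal.2 hx)

theorem oddGen_mul_add (i j : Fin m) :
    oddGen F i * oddGen F j + oddGen F j * oddGen F i = 0 :=
  ExteriorAlgebra.ι_add_mul_swap _ _

theorem listMono_perm (b : Fin m → ℕ) {l l' : List (Fin m)} (h : l.Perm l') :
    listMono F b l = listMono F b l' ∨ listMono F b l = -listMono F b l' := by
  rcases prod_map_perm (oddGen_mul_add (F := F)) h with h | h
  · exact Or.inl (by rw [listMono, h, listMono])
  · exact Or.inr (by rw [listMono, h, listMono, TensorProduct.tmul_neg])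

theorem listMono_mem_of_perm {M : Submodule F (SuperPoly F m)} {b : Fin m → ℕ}
    {l l' : List (Fin m)} (h : l.Perm l') (hM : listMono F b l' ∈ M) : listMono F b l ∈ M := by
  rcases listMono_perm (F := F) b h with h | h <;> rw [h]
  exacts [hM, M.neg_mem hM]

theorem listMono_mul (b : Fin m → ℕ) (l l' : List (Fin m)) (I : Finset (Fin m)) :
    listMono F b l * ((∏ i ∈ I, MvPolynomial.X i) ⊗ₜ[F] (l'.map (oddGen F)).prod) =
      listMono F (fun i => b i + if i ∈ I then 1 else 0) (l ++ l') := by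
  rw [listMono, listMono, Algebra.TensorProduct.tmul_mul_tmul, List.map_append, List.prod_append]
  congr 1
  simp only [pow_add, Finset.prod_mul_distrib]
  congr 1
  simp [pow_ite, Finset.prod_ite_mem]

theorem monoWeight_add (b : Fin m → ℕ) (l l' : List (Fin m)) (I : Finset (Fin m)) :
    monoWeight (fun i => b i + if i ∈ I then 1 else 0) (l ++ l') =
      monoWeight b l + ∑ i ∈ I, (m - (i : ℕ)) + (l'.map fun i : Fin m => m - (i : ℕ)).sum := by
  simp only [monoWeight, add_mul, Finset.sum_add_distrib, List.map_append, List.sum_append, ite_mul,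
    one_mul, zero_mul, Finset.sum_ite_mem, Finset.univ_inter]
  omega

theorem sum_map_sort (S : Finset (Fin m)) (g : Fin m → ℕ) : (S.sort.map g).sum = ∑ i ∈ S, g i := by
  rw [← Finset.sum_map_toList]
  exact ((Finset.sort_perm_toList S (· ≤ ·)).map g).sum_eq

theorem listMono_mul_relLift (b : Fin m → ℕ) (l : List (Fin m)) (a : Fin m → F)
    (S : Finset (Fin m)) :
    listMono F b l * relLift a S = ∑ r ∈ supp a \ S, a r •
      (listMono F (fun i => b i + if i ∈ supp a \ insert r S then 1 else 0) (l ++ S.sort) -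
        ∑ s ∈ S, listMono F (fun i => b i + if i ∈ supp a \ insert r S then 1 else 0)
          (l ++ S.sort.map (Function.update id s r))) := by
  rw [relLift, Finset.mul_sum]
  refine Finset.sum_congr rfl fun r _ => ?_
  rw [mul_smul_comm, TensorProduct.tmul_sub, TensorProduct.tmul_sum, mul_sub, Finset.mul_sum]
  simp only [ordProd_update_comp, listMono_mul]
  rw [ordProd, listMono_mul]

/-- Strong induction on the weight: a nonstandard monomial is, up to sign, a multiple of the
heaviest monomial of some `P_{L,S}`, and is thereby rewritten in lighter ones. -/
theorem listMono_mem_stdSpan (c : Fin m → Fin n → F) (b : Fin m → ℕ) (l : List (Fin m)) :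
    listMono F b l ∈ stdSpan c := by
  induction hN : monoWeight b l using Nat.strong_induction_on generalizing b l with
  | _ N ih =>
  subst hN
  replace ih : ∀ b' l', monoWeight b' l' < monoWeight b l → listMono F b' l' ∈ stdSpan c :=
    fun b' l' h => ih _ h b' l' rfl
  by_cases hl : l.Nodup
  swap
  · rw [listMono, prod_map_eq_zero_of_not_nodup (oddGen_mul_add (F := F))
      (fun i => ExteriorAlgebra.ι_sq_zero _) hl, TensorProduct.tmul_zero]
    exact Submodule.zero_mem _
  by_cases hstd : IsStd c Finset.univ (monoSupp (b, l.toFinset))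
  · refine listMono_mem_of_perm (l' := l.toFinset.sort) ?_
      (Submodule.mem_sup_right (Submodule.subset_span ⟨_, hstd, rfl⟩))
    exact (List.perm_ext_iff_of_nodup hl (Finset.sort_nodup _ _)).2 fun i => by simp
  simp only [IsStd, not_forall, not_not] at hstd
  obtain ⟨a, -, ha, j, hj, hmax, hsub⟩ := hstd
  have hrel : IsRelation c a := isRelation_iff.2 ⟨fun h => mem_supp.1 hj (by simp [h]), ha⟩
  -- `S` collects the indices of `|L| \ {j}` that occur as odd generators; the others must then
  -- occur as some `tᵢ`.
  let S : Finset (Fin m) := (supp a).erase j ∩ l.toFinset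
  have hSa : S ⊆ supp a := Finset.inter_subset_left.trans (Finset.erase_subset _ _)
  have hjS : j ∉ S := fun h => by simp [S] at h
  have hjd : j ∈ supp a \ S := Finset.mem_sdiff.2 ⟨hj, hjS⟩
  let l' := l.filter (· ∉ S)
  have hperm : l.Perm (l' ++ S.sort) := by
    refine (List.perm_ext_iff_of_nodup hl ?_).2 fun i => ?_
    · rw [List.nodup_append]
      refine ⟨hl.filter _, Finset.sort_nodup _ _, fun x hx y hy hxy => ?_⟩
      subst hxy
      simp only [l', List.mem_filter, decide_eq_true_eq] at hx
      exact hx.2 ((Finset.mem_sort _).1 hy)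
    · simp only [l', List.mem_append, List.mem_filter, decide_eq_true_eq, Finset.mem_sort]
      have : i ∈ S → i ∈ l := fun h => List.mem_toFinset.1 (Finset.mem_inter.1 h).2
      tauto
  -- The exponents after dividing by the even part of the leading monomial; they are positive where
  -- `1` is subtracted, as `hb` verifies.
  let b' : Fin m → ℕ := fun i => if i ∈ supp a \ insert j S then b i - 1 else b i
  have hb : (fun i => b' i + if i ∈ supp a \ insert j S then 1 else 0) = b := by
    funext i
    simp only [b']
    split_ifs with hi
    · have hi' : i ∈ (supp a).erase j ∧ i ∉ l.toFinset := by
        simp only [S, Finset.mem_sdiff, Finset.mem_insert, Finset.mem_inter, Finset.mem_erase,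
          not_or] at hi ⊢
        tauto
      have h := mem_monoSupp.1 (hsub hi'.1)
      simp only [monoDeg, if_neg hi'.2] at h
      omega
    · rfl
  refine listMono_mem_of_perm hperm ?_
  have hw : ∀ i ∈ supp a, i ≠ j → m - (j : ℕ) < m - (i : ℕ) := fun i hi hij => by
    have h1 : i < j := lt_of_le_of_ne (hmax i hi) hij
    have h2 := j.isLt
    rw [Fin.lt_def] at h1
    omega
  have hweight : monoWeight b l = monoWeight b' l' + ∑ i ∈ supp a \ insert j S, (m - (i : ℕ)) +
      ∑ i ∈ S, (m - (i : ℕ)) := by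
    rw [← sum_map_sort S, ← monoWeight_add, hb, monoWeight, monoWeight, (hperm.map _).sum_eq]
  have hsum : ∀ r ∈ supp a \ S, ∑ i ∈ supp a \ insert r S, (m - (i : ℕ)) + (m - (r : ℕ)) =
      ∑ i ∈ supp a \ S, (m - (i : ℕ)) := fun r hr => by
    rw [Finset.sdiff_insert]
    exact Finset.sum_erase_add _ _ hr
  -- Here `r` is omitted instead of `j`, so the weight drops because `r < j`.
  have hm1 : ∀ r ∈ supp a \ S, r ≠ j →
      listMono F (fun i => b' i + if i ∈ supp a \ insert r S then 1 else 0) (l' ++ S.sort) ∈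
        stdSpan c := fun r hr hrj => by
    refine ih _ _ ?_
    rw [hweight, monoWeight_add, sum_map_sort]
    have h1 := hsum r hr
    have h2 := hsum j hjd
    have h3 := hw r (Finset.mem_sdiff.1 hr).1 hrj
    omega
  -- Here `s` is omitted, so the weight drops for every `r`, including `r = j`.
  have hm2 : ∀ r ∈ supp a \ S, ∀ s ∈ S,
      listMono F (fun i => b' i + if i ∈ supp a \ insert r S then 1 else 0)
        (l' ++ S.sort.map (Function.update id s r)) ∈ stdSpan c := fun r hr s hs => by
    refine ih _ _ ?_
    rw [hweight, monoWeight_add, List.map_map, sum_map_sort]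
    have h1 := hsum r hr
    have h2 := hsum j hjd
    have h3 := hw s (hSa hs) fun e => hjS (e ▸ hs)
    have h4 : ∑ i ∈ S, ((fun i : Fin m => m - (i : ℕ)) ∘ Function.update id s r) i =
        ∑ i ∈ S.erase s, (m - (i : ℕ)) + (m - (r : ℕ)) := by
      rw [← Finset.sum_erase_add _ _ hs]
      congr 1
      · refine Finset.sum_congr rfl fun i hi => ?_
        simp [Finset.ne_of_mem_erase hi]
      · simp
    have h5 := Finset.sum_erase_add S (fun i : Fin m => m - (i : ℕ)) hs
    rw [h4]
    omega
  have hq := mem_stdSpan_of_mem_span_relSet (c := c)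
    ((TwoSidedIdeal.span (relSet c)).mul_mem_left (listMono F b' l') _
      (TwoSidedIdeal.subset_span (relLift_mem_relSet hrel hSa)))
  rw [listMono_mul_relLift, ← Finset.add_sum_erase _ _ hjd, hb] at hq
  -- All terms but the leading one are in the span; its coefficient `a j` is invertible.
  have h1 := (Submodule.add_mem_iff_left _ (Submodule.sum_mem _ fun r hr => ?_)).1 hq
  · have h2 := Submodule.smul_mem _ (a j)⁻¹ h1
    rw [smul_smul, inv_mul_cancel₀ (mem_supp.1 hj), one_smul] at h2
    refine (Submodule.sub_mem_iff_left _ (Submodule.sum_mem _ fun s hs => ?_)).1 h2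
    have := hm2 j hjd s hs
    rwa [hb] at this
  · rw [Finset.mem_erase] at hr
    exact Submodule.smul_mem _ _ (Submodule.sub_mem _ (hm1 r hr.2 hr.1)
      (Submodule.sum_mem _ fun s hs => hm2 r hr.2 s hs))

theorem span_prod_oddGen :
    Submodule.span F (Set.range fun l : List (Fin m) => (l.map (oddGen F)).prod) = ⊤ := by
  rw [eq_top_iff]
  rintro w -
  induction w using ExteriorAlgebra.induction with
  | algebraMap r =>
    rw [Algebra.algebraMap_eq_smul_one]
    exact Submodule.smul_mem _ _ (Submodule.subset_span ⟨[], by simp⟩)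
  | ι v =>
    rw [pi_eq_sum_univ' v, map_sum]
    refine Submodule.sum_mem _ fun i _ => ?_
    rw [map_smul]
    exact Submodule.smul_mem _ _ (Submodule.subset_span ⟨[i], by simp⟩)
  | mul x y hx hy =>
    refine (Submodule.span_mul_span F _ _).le.trans (Submodule.span_mono ?_)
      (Submodule.mul_mem_mul hx hy)
    rintro _ ⟨_, ⟨l, rfl⟩, _, ⟨l', rfl⟩, rfl⟩
    exact ⟨l ++ l', by simp⟩
  | add x y hx hy => exact Submodule.add_mem _ hx hy

theorem mem_stdSpan (c : Fin m → Fin n → F) (x : SuperPoly F m) : x ∈ stdSpan c := by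
  induction x using TensorProduct.induction_on with
  | zero => exact Submodule.zero_mem _
  | add x y hx hy => exact Submodule.add_mem _ hx hy
  | tmul p w =>
    rw [p.as_sum, TensorProduct.sum_tmul]
    refine Submodule.sum_mem _ fun d _ => ?_
    have hw : w ∈ Submodule.span F
        (Set.range fun l : List (Fin m) => (l.map (oddGen F)).prod) := by
      rw [span_prod_oddGen]
      trivial
    induction hw using Submodule.span_induction with
    | zero => rw [TensorProduct.tmul_zero]; exact Submodule.zero_mem _
    | add w w' _ _ h h' => rw [TensorProduct.tmul_add]; exact Submodule.add_mem _ h h'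
    | smul r w _ h => rw [TensorProduct.tmul_smul]; exact Submodule.smul_mem _ _ h
    | mem w hw =>
      obtain ⟨l, rfl⟩ := hw
      have h := Submodule.smul_mem _ (p.coeff d) (listMono_mem_stdSpan c d l)
      rwa [listMono, TensorProduct.smul_tmul', MvPolynomial.smul_eq_C_mul,
        ← Finsupp.prod_fintype _ _ (fun i => pow_zero _), ← MvPolynomial.monomial_eq] at h

end Spanning

/-! ### The kernel and the image of `ψ` -/

section Kernel

variable {F : Type*} [Field F] {n m : ℕ}

theorem psi_listMono (c : Fin m → Fin n → F) (b : Fin m → ℕ) (l : List (Fin m)) :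
    psi c (listMono F b l) =
      ((∏ i, (Localization.mk 1 ⟨forms c i, Submonoid.subset_closure (Set.mem_range_self i)⟩ :
        Localization (denominators (forms c))) ^ b i) *
        (l.map fun i =>
          (Localization.mk 1 ⟨forms c i, Submonoid.subset_closure (Set.mem_range_self i)⟩ :
            Localization (denominators (forms c)))).prod) ⊗ₜ[F]
        (l.map fun i => ExteriorAlgebra.ι F (c i)).prod := by
  have h1 : psiOdd c (l.map (oddGen F)).prod =
      (l.map fun i =>
        (Localization.mk 1 ⟨forms c i, Submonoid.subset_closure (Set.mem_range_self i)⟩ :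
          Localization (denominators (forms c)))).prod ⊗ₜ[F]
        (l.map fun i => ExteriorAlgebra.ι F (c i)).prod := by
    induction l with
    | nil => simp [Algebra.TensorProduct.one_def]
    | cons i l ih =>
      have : psiOdd c (oddGen F i) = dlog c i := by
        simp [psiOdd, Fintype.linearCombination_apply_single]
      rw [List.map_cons, List.prod_cons, map_mul, ih, this, dlog, zInv, form]
      simp [Algebra.TensorProduct.tmul_mul_tmul]
  rw [listMono, psi, Algebra.TensorProduct.lift_tmul, h1, psiEven, AlgHom.comp_apply,
    Algebra.TensorProduct.includeLeft_apply, map_prod, Algebra.TensorProduct.tmul_mul_tmul, one_mul]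
  simp only [map_pow, MvPolynomial.aeval_X]

theorem toLoc_clearedMono (c : Fin m → Fin n → F) (e : Fin m → ℕ)
    (x : (Fin m → ℕ) × Finset (Fin m)) (hx : ∀ i, monoDeg x i ≤ e i) :
    toLoc (forms c) (clearedMono c Finset.univ e x) =
      toLoc (forms c) ((∏ i, forms c i ^ e i) ⊗ₜ[F] 1) * psi c (listMono F x.1 x.2.sort) := by
  rw [psi_listMono, toLoc, clearedMono, Algebra.TensorProduct.map_tmul,
    Algebra.TensorProduct.map_tmul, Algebra.TensorProduct.tmul_mul_tmul, map_one, one_mul,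
    Finset.inter_univ, ordProd, AlgHom.id_apply]
  congr 1
  have h : (x.2.sort.map fun i =>
      (Localization.mk 1 ⟨forms c i, Submonoid.subset_closure (Set.mem_range_self i)⟩ :
        Localization (denominators (forms c)))).prod = ∏ i ∈ x.2,
      (Localization.mk 1 ⟨forms c i, Submonoid.subset_closure (Set.mem_range_self i)⟩ :
        Localization (denominators (forms c))) := by
    rw [← Finset.prod_map_toList]
    exact ((Finset.sort_perm_toList x.2 (· ≤ ·)).map _).prod_eq
  rw [h, ← Finset.univ_inter x.2, ← Finset.prod_ite_mem, ← Finset.prod_mul_distrib, map_prod,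
    map_prod, ← Finset.prod_mul_distrib]
  refine Finset.prod_congr rfl fun i _ => ?_
  have h1 := mk_one_mul_algebraMap (forms c) i
  have h2 : ∀ τ : Localization (denominators (forms c)),
      (τ ^ x.1 i * if i ∈ x.2 then τ else 1) = τ ^ monoDeg x i := fun τ => by
    rw [monoDeg, pow_add]
    congr 1
    split_ifs <;> simp
  rw [h2, map_pow, map_pow, IsScalarTower.coe_toAlgHom', ← Nat.sub_add_cancel (hx i), pow_add,
    Nat.add_sub_cancel, mul_assoc, ← mul_pow, mul_comm (algebraMap _ _ _), h1, one_pow, mul_one]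

theorem ker_le_span_relSet {c : Fin m → Fin n → F} (hc : ∀ i, linForm (c i) ≠ 0) :
    TwoSidedIdeal.ker (psi c) ≤ TwoSidedIdeal.span (relSet c) := by
  intro x hx
  rw [TwoSidedIdeal.mem_ker] at hx
  obtain ⟨y, hy, z, hz, rfl⟩ := Submodule.mem_sup.1 (mem_stdSpan c x)
  replace hy : y ∈ TwoSidedIdeal.span (relSet c) := TwoSidedIdeal.mem_asIdeal.1 hy
  have hy0 : psi c y = 0 := (TwoSidedIdeal.mem_ker _).1 (span_relSet_le_ker c hy)
  rw [map_add, hy0, zero_add] at hx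
  obtain ⟨f, hf, rfl⟩ := (Finsupp.mem_span_image_iff_linearCombination F).1 hz
  -- A common denominator: the largest degree at each index among the monomials that occur.
  let e : Fin m → ℕ := fun i => f.support.sup fun x => monoDeg x i
  have he : ∀ x ∈ f.support, ∀ i, monoDeg x i ≤ e i := fun x hx i =>
    Finset.le_sup (f := fun x => monoDeg x i) hx
  have hsum : ∑ x ∈ f.support, f x • clearedMono c Finset.univ e x = 0 := by
    refine toLoc_injective hc ?_
    have h := congrArg (toLoc (forms c) ((∏ i, forms c i ^ e i) ⊗ₜ[F] 1) * ·) hx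
    simp only [mul_zero, Finsupp.linearCombination_apply, Finsupp.sum, map_sum, map_smul,
      Finset.mul_sum, mul_smul_comm] at h
    rw [map_zero, ← h, map_sum]
    exact Finset.sum_congr rfl fun x hx => by rw [map_smul, toLoc_clearedMono c e x (he x hx)]
  have h0 := stdIndep Finset.univ c e f.support f
    ⟨fun x _ y _ h h' => Prod.ext (funext fun i => h i (Finset.mem_univ i))
      (Finset.ext fun i => h' i (Finset.mem_univ i)), fun x hx i _ => he x hx i,
      fun x hx => hf hx⟩ hsum
  have hf0 : f = 0 := Finsupp.ext fun x => by
    by_contra hne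
    exact hne (h0 x (Finsupp.mem_support_iff.2 hne))
  rw [hf0, map_zero, add_zero]
  exact hy

theorem range_psi (c : Fin m → Fin n → F) : (psi c).range = recipRing c := by
  refine le_antisymm ?_ (Algebra.adjoin_le ?_)
  · have ht : ∀ i, zInv (forms c) i ∈ recipRing c := fun i =>
      Algebra.subset_adjoin (Or.inl ⟨i, rfl⟩)
    have hu : ∀ i, dlog c i ∈ recipRing c := fun i => Algebra.subset_adjoin (Or.inr ⟨i, rfl⟩)
    rintro _ ⟨x, rfl⟩
    change psi c x ∈ recipRing c
    induction x using TensorProduct.induction_on with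
    | zero => rw [map_zero]; exact Subalgebra.zero_mem _
    | add x y hx hy => rw [map_add]; exact Subalgebra.add_mem _ hx hy
    | tmul p w =>
      rw [psi, Algebra.TensorProduct.lift_tmul]
      refine Subalgebra.mul_mem _ ?_ ?_
      · induction p using MvPolynomial.induction_on with
        | C r =>
          rw [← MvPolynomial.algebraMap_eq, AlgHom.commutes]
          exact Subalgebra.algebraMap_mem _ _
        | add p q hp hq => rw [map_add]; exact Subalgebra.add_mem _ hp hq
        | mul_X p i hp =>
          rw [map_mul]
          refine Subalgebra.mul_mem _ hp ?_
          simpa [psiEven, zInv] using ht i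
      · induction w using ExteriorAlgebra.induction with
        | algebraMap r =>
          rw [AlgHom.commutes]
          exact Subalgebra.algebraMap_mem _ _
        | ι v =>
          rw [psiOdd, ExteriorAlgebra.lift_ι_apply, Fintype.linearCombination_apply]
          exact Subalgebra.sum_mem _ fun i _ => Subalgebra.smul_mem _ (hu i) _
        | mul x y hx hy => rw [map_mul]; exact Subalgebra.mul_mem _ hx hy
        | add x y hx hy => rw [map_add]; exact Subalgebra.add_mem _ hx hy
  · rintro _ (⟨i, rfl⟩ | ⟨i, rfl⟩)
    exacts [⟨t F i, psi_t c i⟩, ⟨u F i, psi_u c i⟩]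

theorem exists_quotient_equiv {c : Fin m → Fin n → F} {I : TwoSidedIdeal (SuperPoly F m)}
    (hI : TwoSidedIdeal.ker (psi c) = I) :
    ∃ e : I.ringCon.Quotient ≃ₐ[F] recipRing c,
      ∀ x, ((e (I.ringCon.mk' x) : recipRing c) : SuperLoc (forms c)) = psi c x := by
  subst hI
  let f : SuperPoly F m →ₐ[F] recipRing c :=
    (psi c).codRestrict (recipRing c) fun x => range_psi c ▸ AlgHom.mem_range_self _ x
  -- Both congruences relate `x` and `y` when `psi c x = psi c y`; restricting the codomain does not
  -- affect this.
  have hle : (TwoSidedIdeal.ker (psi c)).ringCon ≤ RingCon.ker f.toRingHom :=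
    fun x y h => Subtype.ext h
  refine ⟨AlgEquiv.ofBijective (RingCon.liftₐ _ f hle) ⟨?_, ?_⟩, fun x => rfl⟩
  · intro x y h
    obtain ⟨x, rfl⟩ := RingCon.mk'_surjective _ x
    obtain ⟨y, rfl⟩ := RingCon.mk'_surjective _ y
    exact (RingCon.eq _).2 (congrArg Subtype.val h)
  · rintro ⟨y, hy⟩
    rw [← range_psi] at hy
    obtain ⟨x, rfl⟩ := hy
    exact ⟨RingCon.mk' _ x, rfl⟩

end Kernel

end RecipPlane

end

theorem theorem2 {F : Type*} [Field F] (n m : ℕ) (c : Fin m → Fin n → F)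
    (hc : ∀ i, RecipPlane.linForm (c i) ≠ 0) :
    (∀ (a : Fin m → F) (S : Finset (Fin m)), RecipPlane.IsRelation c a → S ⊆ RecipPlane.supp a →
      ∃! p : RecipPlane.SuperPoly F m, RecipPlane.toXiLoc F m p = RecipPlane.relElt a S) ∧
    TwoSidedIdeal.ker (RecipPlane.psi c) = TwoSidedIdeal.span (RecipPlane.relSet c) ∧
    ∃ e : (TwoSidedIdeal.span (RecipPlane.relSet c)).ringCon.Quotient ≃ₐ[F]
        RecipPlane.recipRing c,
      ∀ ξ : RecipPlane.SuperPoly F m,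
        ((e ((TwoSidedIdeal.span (RecipPlane.relSet c)).ringCon.mk' ξ) :
          RecipPlane.recipRing c) : RecipPlane.SuperLoc (RecipPlane.forms c)) =
          RecipPlane.psi c ξ := by
  have hker : TwoSidedIdeal.ker (RecipPlane.psi c) = TwoSidedIdeal.span (RecipPlane.relSet c) :=
    le_antisymm (RecipPlane.ker_le_span_relSet hc) (RecipPlane.span_relSet_le_ker c)
  exact ⟨fun a _ _ hS => RecipPlane.existsUnique_toXiLoc_eq_relElt a hS, hker,
    RecipPlane.exists_quotient_equiv hker⟩
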